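/- \textbf{Consistent sets.} A consistent set object over a set $A$ of items is a shared object with two atomic (linearizable) operations, $\mathrm{insert}(x)$ for $x \in A$, and $\mathrm{remove}()$. Its state is the finite sequence $s_1,\dots,s_m$ of the items it currently contains, in order of insertion (several copies of the same item may be present). $\mathrm{insert}(x)$ appends $x$ to this sequence and returns no information. If $m \ge 1$, $\mathrm{remove}()$ deletes and returns one of the entries, $s_i = F(s_1,\dots,s_m)$, where $F$ is a fixed function, defined on all nonempty finite sequences of items, that selects an entry of the sequence; if $m = 0$, it returns a special value $\mathrm{null} \notin A$ and the state stays empty. The function $F$ has the following two consistency properties for all items $a, b \in A$, where $a$ and $b$ refer to the displayed entries and $L, M, R, L', M', R'$ denote possibly empty sequences of items. \begin{itemize} \item If $F(L,a,M,b,R)=a$ for some $L,M,R$, then there are no $L',M',R'$ with $F(L',a,M',b,R')=b$. \item If $F(L,a,M,b,R)=b$ for some $L,M,R$, then there are no $L',M',R'$ with $F(L',a,M',b,R')=a$. \end{itemize} (First-in-first-out queues, stacks and priority queues are examples.) \textbf{Consensus.} Let $V$ be a set of possible inputs with at least two elements. Two processes $0$ and $1$ each run a deterministic program, which may depend on the identity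 of the process and on its input $v_i \in V$. Each step of a process is a call of $\mathrm{insert}$ or $\mathrm{remove}$ on the single shared object; there is no other shared memory. A process may at some point return a value in $V$ and halt. Steps of the two processes are interleaved by an arbitrary asynchronous schedule. The programs solve wait-free two-process consensus if, for all inputs and all schedules: every process that keeps taking steps returns after finitely many of them, whatever the other process does (wait-freedom); the two processes never return different values (agreement); and every returned value is the input of one of the two processes (validity). \textbf{Theorem.} It is impossible to solve wait-free two-process consensus using a single consistent set object initialized in an empty state. That is, for every set $A$ of items and every function $F$ with the consistency properties, no pair of programs solves wait-free two-process consensus using a single consistent set object with selection function $F$ that initially contains no items. -/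

import Mathlib

/-- A consistent set with items from `α`, given by its selection function `F`. A state of the object
is the list of the items it contains, in order of insertion (the same value may occur several times).
From a nonempty state `s₁, …, s_m`, the function `F` selects one of the entries; `pick` gives the
(zero-based) position of the selected entry, so that "`F(L, a, M, b, R) = a`" for the displayed `a`
reads `pick (L ++ [a] ++ M ++ [b] ++ R) = L.length`. (`pick []` is never used.) -/
structure ConsistentSet (α : Type*) where
  pick : List α → ℕ
  pick_lt : ∀ l : List α, l ≠ [] → pick l < l.length
  /-- If the earlier of `a, b` is ever selected in the presence of the later one, then
  the later one is never selected in the presence of the earlier one. -/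
  consistent_fst : ∀ (a b : α) (L M R : List α),
    pick (L ++ [a] ++ M ++ [b] ++ R) = L.length →
      ¬ ∃ L' M' R' : List α, pick (L' ++ [a] ++ M' ++ [b] ++ R') = (L' ++ [a] ++ M').length
  /-- If the later of `a, b` is ever selected in the presence of the earlier one, then
  the earlier one is never selected in the presence of the later one. -/
  consistent_snd : ∀ (a b : α) (L M R : List α),
    pick (L ++ [a] ++ M ++ [b] ++ R) = (L ++ [a] ++ M).length →
      ¬ ∃ L' M' R' : List α, pick (L' ++ [a] ++ M' ++ [b] ++ R') = L'.length

namespace ConsistentSet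

variable {α : Type*} (O : ConsistentSet α)

/-- The state after `insert x`. -/
def insertState (l : List α) (x : α) : List α := l ++ [x]

/-- The response of `remove` in state `l`: the selected item, or null (`none`) if `l` is empty. -/
def removeResponse (l : List α) : Option α := l[O.pick l]?

/-- The state after `remove`: the selected entry is deleted. -/
def removeState (l : List α) : List α := l.eraseIdx (O.pick l)

end ConsistentSet

/-- What a process does next in a given local state: call `insert x` and continue in local state `s`,
call `remove` and continue in a local state that depends on the response, or return the value `v`
(and halt). -/
inductive Instr (α V σ : Type*) where
  | insert (x : α) (s : σ) : Instr α V σ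
  | remove (k : Option α → σ) : Instr α V σ
  | decide (v : V) : Instr α V σ

/-- A deterministic two-process protocol over one shared object with items in `α`, with inputs and
outputs in `V` and local states in `σ`. Processes have no shared memory other than the object. -/
structure Protocol (α V σ : Type*) where
  /-- The initial local state of process `i` on input `v`. -/
  start : Fin 2 → V → σ
  /-- The program of process `i`. -/
  instr : Fin 2 → σ → Instr α V σ

/-- A global configuration: the local states of the processes and the state of the object. -/
structure Config (α σ : Type*) where
  loc : Fin 2 → σ
  items : List α

namespace Protocol

variable {α V σ : Type*} (P : Protocol α V σ)

/-- The value returned by process `i` if it has returned in configuration `c`. -/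
def decision (c : Config α σ) (i : Fin 2) : Option V :=
  match P.instr i (c.loc i) with
  | .insert _ _ => none
  | .remove _ => none
  | .decide v => some v

/-- Process `i` takes one atomic step; nothing happens if it has already returned. -/
def step (O : ConsistentSet α) (c : Config α σ) (i : Fin 2) : Config α σ :=
  match P.instr i (c.loc i) with
  | .insert x s => ⟨Function.update c.loc i s, ConsistentSet.insertState c.items x⟩
  | .remove k =>
      ⟨Function.update c.loc i (k (O.removeResponse c.items)), O.removeState c.items⟩
  | .decide _ => c

/-- The configuration after the first `n` steps of the schedule `s` (where `s m` is the process
that moves at time `m`), with process `i` started on input `inp i` and the object in state `l₀`. -/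
def exec (O : ConsistentSet α) (l₀ : List α) (inp : Fin 2 → V) (s : ℕ → Fin 2) :
    ℕ → Config α σ
  | 0 => ⟨fun i => P.start i (inp i), l₀⟩
  | n + 1 => P.step O (exec O l₀ inp s n) (s n)

/-- Wait-freedom: in every execution, each process that keeps taking steps returns,
no matter how (and whether) the other process is scheduled. -/
def WaitFree (O : ConsistentSet α) (l₀ : List α) : Prop :=
  ∀ (inp : Fin 2 → V) (s : ℕ → Fin 2) (i : Fin 2), (∀ n, ∃ m, n ≤ m ∧ s m = i) →
    ∃ n v, P.decision (P.exec O l₀ inp s n) i = some v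

/-- Agreement: the processes never return different values. -/
def Agreement (O : ConsistentSet α) (l₀ : List α) : Prop :=
  ∀ (inp : Fin 2 → V) (s : ℕ → Fin 2) (n : ℕ) (v w : V),
    P.decision (P.exec O l₀ inp s n) 0 = some v →
      P.decision (P.exec O l₀ inp s n) 1 = some w → v = w

/-- Validity: every returned value is the input of one of the processes. -/
def Validity (O : ConsistentSet α) (l₀ : List α) : Prop :=
  ∀ (inp : Fin 2 → V) (s : ℕ → Fin 2) (n : ℕ) (i : Fin 2) (v : V),
    P.decision (P.exec O l₀ inp s n) i = some v → ∃ j, v = inp j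

/-- `P` solves wait-free two-process consensus using the single object `O` with initial state `l₀`. -/
def SolvesConsensus (O : ConsistentSet α) (l₀ : List α) : Prop :=
  P.WaitFree O l₀ ∧ P.Agreement O l₀ ∧ P.Validity O l₀

end Protocol

/-! Consistency makes the object a priority list: a new item goes in front of the first entry that
it beats in a two-entry state, and `remove` takes the head (`isPriority_beats`,
`RemovalOrder.insert`).

Call a step private if it inserts, removes from an empty object, or removes an item that its own
process inserted. Under private steps each process sees exactly what it would see running alone.
Hence it can only return its own input, by validity, and private executions are finite, by
wait-freedom (`LooksSolo.next`, `WaitFree.terminates`). With distinct inputs, agreement then forbids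
a private execution in which both processes return.

Yet from the empty object either process can run alone and return. A valence argument in the style
of Newman's lemma makes this contradictory: by well-founded induction, no configuration lets each of
the two processes finish. Private steps can get stuck only after some process has returned
(`exists_canFinish`), and private steps of different processes lead to configurations from which a
common process can finish (`exists_canFinish_of_private_of_private`). -/

/-! ### Insertion into a priority list

For a relation `r`, where `r x a` means that a newly inserted `x` is placed in front of `a`. -/

namespace List

variable {β : Type*} {r : β → β → Prop}

/-- `a` may stand in front of `b`: whatever is placed in front of `a` is placed in front of `b`. -/
def Outranks (r : β → β → Prop) (a b : β) : Prop := ∀ y, r y a → r y b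

/-- A newcomer outranks precisely what it is placed in front of, up to ties. -/
structure IsPriority (r : β → β → Prop) : Prop where
  of_rel : ∀ {x a}, r x a → Outranks r x a
  of_not_rel : ∀ {x a}, ¬ r x a → Outranks r a x

theorem orderedInsert_of_forall [DecidableRel r] {x : β} {s : List β} (h : ∀ b ∈ s, r x b) :
    s.orderedInsert r x = x :: s := by
  cases s with
  | nil => rfl
  | cons c t => simp [orderedInsert, h c (by simp)]

theorem forall_rel_of_pairwise_outranks {x c : β} {t : List β}
    (hs : (c :: t).Pairwise (Outranks r)) (h : r x c) : ∀ b ∈ c :: t, r x b := by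
  intro b hb
  rcases mem_cons.1 hb with rfl | hb
  · exact h
  · exact (pairwise_cons.1 hs).1 b hb x h

theorem IsPriority.pairwise_orderedInsert [DecidableRel r] (hr : IsPriority r) (x : β)
    {s : List β} (hs : s.Pairwise (Outranks r)) :
    (s.orderedInsert r x).Pairwise (Outranks r) := by
  induction s with
  | nil => simp
  | cons c t ih =>
    by_cases h : r x c
    · simp only [orderedInsert, h, if_true]
      refine pairwise_cons.2 ⟨fun b hb => ?_, hs⟩
      exact hr.of_rel (forall_rel_of_pairwise_outranks hs h b hb)
    · simp only [orderedInsert, h, if_false]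
      rw [pairwise_cons] at hs ⊢
      refine ⟨fun b hb => ?_, ih hs.2⟩
      rcases (mem_orderedInsert r).1 hb with rfl | hb
      · exact hr.of_not_rel h
      · exact hs.1 b hb

/-- In an ordered list, the entries that `x` is placed in front of form a final segment, so deleting
entries does not affect where `x` goes among the others. This makes one process's items evolve as if
the other's were absent. -/
theorem filter_orderedInsert_of_pairwise [DecidableRel r] (p : β → Bool) (x : β) {s : List β}
    (hs : s.Pairwise (Outranks r)) :
    (s.orderedInsert r x).filter p =
      if p x then (s.filter p).orderedInsert r x else s.filter p := by
  induction s with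
  | nil => by_cases hx : p x <;> simp [hx]
  | cons c t ih =>
    by_cases h : r x c
    · have hall := forall_rel_of_pairwise_outranks hs h
      rw [orderedInsert_of_forall hall,
        orderedInsert_of_forall fun b hb => hall b (mem_filter.1 hb).1, filter_cons]
    · have ih := ih (pairwise_cons.1 hs).2
      by_cases hc : p c <;> by_cases hx : p x <;> simp_all [orderedInsert]

theorem map_orderedInsert_comap {γ : Type*} (f : γ → β) [DecidableRel r]
    [DecidableRel fun x y => r (f x) (f y)] (x : γ) (s : List γ) :
    (s.orderedInsert (fun x y => r (f x) (f y)) x).map f = (s.map f).orderedInsert r (f x) := by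
  induction s with
  | nil => rfl
  | cons c t ih => by_cases h : r (f x) (f c) <;> simp [orderedInsert, h, ih]

/-- Two insertions commute, or the results differ by a swap of the two adjacent new entries. -/
theorem IsPriority.orderedInsert_comm_or_swap [DecidableRel r] (hr : IsPriority r) (x y : β)
    (s : List β) :
    (s.orderedInsert r x).orderedInsert r y = (s.orderedInsert r y).orderedInsert r x ∨
    ∃ U D a b, (a = x ∧ b = y ∨ a = y ∧ b = x) ∧
      (s.orderedInsert r x).orderedInsert r y = U ++ a :: b :: D ∧
      (s.orderedInsert r y).orderedInsert r x = U ++ b :: a :: D := by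
  -- Both newcomers land at the same place. Their order depends on the order of insertion exactly
  -- when each goes in front of the other (as in a stack) or neither does (as in a queue).
  have top : ∀ D : List β,
      (if r y x then y :: x :: D else x :: y :: D) = (if r x y then x :: y :: D else y :: x :: D) ∨
      ∃ U D' a b, (a = x ∧ b = y ∨ a = y ∧ b = x) ∧
        (if r y x then y :: x :: D else x :: y :: D) = U ++ a :: b :: D' ∧
        (if r x y then x :: y :: D else y :: x :: D) = U ++ b :: a :: D' := by
    intro D
    by_cases h₁ : r y x <;> by_cases h₂ : r x y <;> simp only [h₁, h₂, if_true, if_false]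
    · exact Or.inr ⟨[], D, y, x, by simp⟩
    · exact Or.inl trivial
    · exact Or.inl trivial
    · exact Or.inr ⟨[], D, x, y, by simp⟩
  induction s with
  | nil => simpa [orderedInsert] using top []
  | cons c t ih =>
    by_cases hx : r x c <;> by_cases hy : r y c
    · simpa [orderedInsert, hx, hy] using top (c :: t)
    · have h : ¬ r y x := fun h => hy (hr.of_rel hx y h)
      exact Or.inl (by simp [orderedInsert, hx, hy, h])
    · have h : ¬ r x y := fun h => hx (hr.of_rel hy x h)
      exact Or.inl (by simp [orderedInsert, hx, hy, h])
    · simp only [orderedInsert, hx, hy, if_false]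
      rcases ih with h | ⟨U, D, a, b, hab, h₁, h₂⟩
      · exact Or.inl (by rw [h])
      · exact Or.inr ⟨c :: U, D, a, b, hab, by rw [h₁, cons_append], by rw [h₂, cons_append]⟩

/-- A newcomer goes in front of both tied entries or of neither, so it never separates them. -/
theorem orderedInsert_append_swap [DecidableRel r] {a b : β} (hab : Outranks r a b)
    (hba : Outranks r b a) (z : β) (U D : List β) :
    ∃ U' D', (U ++ a :: b :: D).orderedInsert r z = U' ++ a :: b :: D' ∧
      (U ++ b :: a :: D).orderedInsert r z = U' ++ b :: a :: D' := by
  induction U with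
  | nil =>
    by_cases h : r z a
    · have h' := hab z h
      exact ⟨[z], D, by simp [h], by simp [h']⟩
    · have h' : ¬ r z b := fun h' => h (hba z h')
      exact ⟨[], D.orderedInsert r z, by simp [h, h'], by simp [h, h']⟩
  | cons c U ih =>
    by_cases h : r z c
    · exact ⟨z :: c :: U, D, by simp [h], by simp [h]⟩
    · obtain ⟨U', D', h₁, h₂⟩ := ih
      exact ⟨c :: U', D', by simp [h, h₁], by simp [h, h₂]⟩

theorem orderedInsert_append_erase [DecidableRel r] {a : β} (z : β) {U D : List β}
    (hs : (U ++ a :: D).Pairwise (Outranks r)) :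
    ∃ U' D', (U ++ a :: D).orderedInsert r z = U' ++ a :: D' ∧
      (U ++ D).orderedInsert r z = U' ++ D' ∧ ∀ u ∈ U', u ∈ U ∨ u = z := by
  induction U with
  | nil =>
    by_cases h : r z a
    · have hall := forall_rel_of_pairwise_outranks hs h
      refine ⟨[z], D, by simp [h], ?_, by simp⟩
      exact orderedInsert_of_forall fun b hb => hall b (mem_cons_of_mem _ hb)
    · exact ⟨[], D.orderedInsert r z, by simp [h], rfl, by simp⟩
  | cons c U ih =>
    by_cases h : r z c
    · refine ⟨z :: c :: U, D, by simp [h], by simp [h], fun u hu => ?_⟩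
      rcases mem_cons.1 hu with rfl | hu <;> simp_all
    · obtain ⟨U', D', h₁, h₂, h₃⟩ := ih (pairwise_cons.1 hs).2
      refine ⟨c :: U', D', by simp [h, h₁], by simp [h, h₂], ?_⟩
      intro u hu
      rcases mem_cons.1 hu with rfl | hu
      · simp
      · rcases h₃ u hu with hu | hu <;> simp [hu]

end List

/-! ### Consistent sets are priority lists -/

namespace ConsistentSet

variable {α : Type*} (O : ConsistentSet α)

/-- A newly inserted `x` is selected in preference to the older entry `a`. -/
def Beats (x a : α) : Prop := O.pick [a, x] = 1

instance : DecidableRel O.Beats := fun x a => inferInstanceAs (Decidable (O.pick [a, x] = 1))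

theorem exists_eq_append_of_getElem? {l : List α} {i j : ℕ} {a b : α} (hij : i < j)
    (hi : l[i]? = some a) (hj : l[j]? = some b) :
    ∃ L M R, l = L ++ [a] ++ M ++ [b] ++ R ∧ L.length = i ∧ (L ++ [a] ++ M).length = j := by
  obtain ⟨hj', rfl⟩ := List.getElem?_eq_some_iff.1 hj
  obtain ⟨hi', rfl⟩ := List.getElem?_eq_some_iff.1 hi
  refine ⟨l.take i, (l.drop (i + 1)).take (j - (i + 1)), l.drop (j + 1), ?_, ?_, ?_⟩
  · have e : l.take i ++ [l[i]] ++ (l.drop (i + 1)).take (j - (i + 1)) = l.take j := by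
      rw [List.take_append_getElem, ← List.take_add]
      congr 1
      omega
    rw [e, List.take_append_getElem, List.take_append_drop]
  · simp; omega
  · simp; omega

theorem pick_ne_later {l l' : List α} {i j i' j' : ℕ} {a b : α} (hij : i < j) (hij' : i' < j')
    (hi : l[i]? = some a) (hj : l[j]? = some b) (hi' : l'[i']? = some a)
    (hj' : l'[j']? = some b) (h : O.pick l = i) : O.pick l' ≠ j' := by
  obtain ⟨L, M, R, rfl, h₁, -⟩ := exists_eq_append_of_getElem? hij hi hj
  obtain ⟨L', M', R', rfl, -, h₂⟩ := exists_eq_append_of_getElem? hij' hi' hj'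
  intro h'
  exact O.consistent_fst a b L M R (h.trans h₁.symm) ⟨L', M', R', h'.trans h₂.symm⟩

theorem pick_ne_earlier {l l' : List α} {i j i' j' : ℕ} {a b : α} (hij : i < j) (hij' : i' < j')
    (hi : l[i]? = some a) (hj : l[j]? = some b) (hi' : l'[i']? = some a)
    (hj' : l'[j']? = some b) (h : O.pick l = j) : O.pick l' ≠ i' :=
  fun h' => O.pick_ne_later hij' hij hi' hj' hi hj h' h

variable {O}

theorem Beats.pick_ne {a x : α} (h : O.Beats x a) {l : List α} {i j : ℕ} (hij : i < j)
    (hi : l[i]? = some a) (hj : l[j]? = some x) : O.pick l ≠ i :=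
  O.pick_ne_earlier (i := 0) (j := 1) (by simp) hij (by simp) (by simp) hi hj h

theorem pick_ne_of_not_beats {a x : α} (h : ¬ O.Beats x a) {l : List α} {i j : ℕ} (hij : i < j)
    (hi : l[i]? = some a) (hj : l[j]? = some x) : O.pick l ≠ j := by
  have h0 : O.pick [a, x] = 0 := by
    have := O.pick_lt [a, x] (by simp)
    have h : O.pick [a, x] ≠ 1 := h
    simp at this
    omega
  exact O.pick_ne_later (i := 0) (j := 1) (by simp) hij (by simp) (by simp) hi hj h0

variable (O)

/-- If either property failed, the three pairwise preferences among `a`, `x`, `y` would be cyclic,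
and no entry of `[a, x, y]` could be selected. -/
theorem isPriority_beats : List.IsPriority O.Beats where
  of_rel {x a} hxa y hyx := by
    by_contra hya
    have h₁ := hxa.pick_ne (l := [a, x, y]) (i := 0) (j := 1) (by simp) (by simp) (by simp)
    have h₂ := hyx.pick_ne (l := [a, x, y]) (i := 1) (j := 2) (by simp) (by simp) (by simp)
    have h₃ := pick_ne_of_not_beats hya (l := [a, x, y]) (i := 0) (j := 2) (by simp) (by simp)
      (by simp)
    have := O.pick_lt [a, x, y] (by simp)
    simp at this
    omega
  of_not_rel {x a} hxa y hya := by
    by_contra hyx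
    have h₁ := pick_ne_of_not_beats hxa (l := [a, x, y]) (i := 0) (j := 1) (by simp) (by simp)
      (by simp)
    have h₂ := pick_ne_of_not_beats hyx (l := [a, x, y]) (i := 1) (j := 2) (by simp) (by simp)
      (by simp)
    have h₃ := hya.pick_ne (l := [a, x, y]) (i := 0) (j := 2) (by simp) (by simp) (by simp)
    have := O.pick_lt [a, x, y] (by simp)
    simp at this
    omega

/-- `s` lists the entries of the state `l` in the order in which `remove` would return them. -/
def RemovalOrder : List α → List α → Prop
  | l, [] => l = []
  | l, a :: s => O.removeResponse l = some a ∧ RemovalOrder (O.removeState l) s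

variable {O}

/-- The selection after appending `x` depends only on whether `x` beats the entry `a` selected
before. If it does, removing `x` restores `l`; if not, `a` is removed and the claim recurs on the
smaller state. -/
theorem RemovalOrder.insert {l s : List α} (h : O.RemovalOrder l s) (x : α) :
    O.RemovalOrder (insertState l x) (s.orderedInsert O.Beats x) := by
  induction s generalizing l with
  | nil =>
    obtain rfl : l = [] := h
    have := O.pick_lt [x] (by simp)
    have h0 : O.pick [x] = 0 := by simpa using this
    simp [RemovalOrder, insertState, removeResponse, removeState, h0]
  | cons a s ih =>
    obtain ⟨h₁, h₂⟩ := h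
    have ih := ih h₂
    simp only [removeResponse, removeState, insertState] at h₁ ih ⊢
    have hi : O.pick l < l.length := (List.getElem?_eq_some_iff.1 h₁).1
    have hm := O.pick_lt (l ++ [x]) (by simp)
    simp only [List.length_append, List.length_singleton] at hm
    have hx : (l ++ [x])[l.length]? = some x := by simp
    have ha : (l ++ [x])[O.pick l]? = some a := by rw [List.getElem?_append_left hi, h₁]
    -- Two different old entries, each selected in the presence of the other, would violate
    -- consistency.
    have hmi : O.pick (l ++ [x]) < l.length → O.pick (l ++ [x]) = O.pick l := by
      intro hlt
      have hget : l[O.pick (l ++ [x])]? = some l[O.pick (l ++ [x])] := List.getElem?_eq_getElem hlt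
      have hget' : (l ++ [x])[O.pick (l ++ [x])]? = some l[O.pick (l ++ [x])] := by
        rw [List.getElem?_append_left hlt, hget]
      rcases lt_trichotomy (O.pick (l ++ [x])) (O.pick l) with h | h | h
      · exact absurd rfl (O.pick_ne_earlier h h hget h₁ hget' ha rfl)
      · exact h
      · exact absurd rfl (O.pick_ne_later h h h₁ hget ha hget' rfl)
    by_cases hb : O.Beats x a
    · have hpick : O.pick (l ++ [x]) = l.length := by
        by_contra hne
        exact hb.pick_ne hi ha hx (hmi (by omega))
      simp only [List.orderedInsert, hb, if_true, RemovalOrder, removeResponse, removeState, hpick]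
      refine ⟨hx, ?_⟩
      rw [List.eraseIdx_append_of_length_le le_rfl]
      simpa using ⟨h₁, h₂⟩
    · have hpick : O.pick (l ++ [x]) = O.pick l :=
        hmi (lt_of_le_of_ne (by omega) (pick_ne_of_not_beats hb hi ha hx))
      simp only [List.orderedInsert, hb, if_false, RemovalOrder, removeResponse, removeState, hpick]
      exact ⟨ha, by rwa [List.eraseIdx_append_of_lt_length hi]⟩

theorem RemovalOrder.removeResponse_eq {l s : List α} (h : O.RemovalOrder l s) :
    O.removeResponse l = s.head? := by
  cases s with
  | nil => obtain rfl : l = [] := h; simp [removeResponse]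
  | cons a s => exact h.1

theorem RemovalOrder.removeState {l s : List α} (h : O.RemovalOrder l s) :
    O.RemovalOrder (O.removeState l) s.tail := by
  cases s with
  | nil => obtain rfl : l = [] := h; simp [RemovalOrder, ConsistentSet.removeState]
  | cons a s => exact h.2

/-- The preference between entries that carry the name of the process that inserted them. -/
abbrev OwnedBeats (O : ConsistentSet α) (x y : α × Fin 2) : Prop := O.Beats x.1 y.1

theorem isPriority_ownedBeats (O : ConsistentSet α) : List.IsPriority O.OwnedBeats where
  of_rel h y hy := O.isPriority_beats.of_rel h y.1 hy
  of_not_rel h y hy := O.isPriority_beats.of_not_rel h y.1 hy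

end ConsistentSet

/-! ### Executions in which each process removes its own items only -/

/-- The local states, and the entries of the object with their owners, in order of removal. -/
structure OwnedConfig (α σ : Type*) where
  loc : Fin 2 → σ
  items : List (α × Fin 2)

namespace Protocol

open Function Relation List

variable {α V σ : Type*} (P : Protocol α V σ) (O : ConsistentSet α)

/-- Process `i` takes a step that does not reveal the presence of the other process. -/
inductive Private (i : Fin 2) (c : OwnedConfig α σ) : OwnedConfig α σ → Prop
  | insert (x : α) (s : σ) (h : P.instr i (c.loc i) = .insert x s) :
      Private i c ⟨update c.loc i s, c.items.orderedInsert O.OwnedBeats (x, i)⟩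
  | null (k : Option α → σ) (h : P.instr i (c.loc i) = .remove k) (hc : c.items = []) :
      Private i c ⟨update c.loc i (k none), []⟩
  | remove (k : Option α → σ) (x : α) (r : List (α × Fin 2))
      (h : P.instr i (c.loc i) = .remove k) (hc : c.items = (x, i) :: r) :
      Private i c ⟨update c.loc i (k (some x)), r⟩

/-- Some process takes a private step. -/
def Next (c d : OwnedConfig α σ) : Prop := ∃ i, P.Private O i c d

/-- Process `i` has returned. -/
def Finished (c : OwnedConfig α σ) (i : Fin 2) : Prop := ∃ v, P.instr i (c.loc i) = .decide v

/-- Some sequence of private steps leads to a configuration where process `i` has returned. -/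
def CanFinish (c : OwnedConfig α σ) (i : Fin 2) : Prop :=
  ∃ d, ReflTransGen (P.Next O) c d ∧ P.Finished d i

/-- There are no infinite sequences of private steps from `c`. -/
abbrev Terminates (c : OwnedConfig α σ) : Prop := Acc (flip (P.Next O)) c

/-- The entries of `c` are ordered by priority. -/
abbrev _root_.OwnedConfig.Ordered (c : OwnedConfig α σ) : Prop :=
  c.items.Pairwise (Outranks O.OwnedBeats)

/-! ### Private executions and which processes can finish -/

variable {P O} {c d e : OwnedConfig α σ} {i j : Fin 2}

theorem CanFinish.of_next (h : P.Next O c d) (hd : P.CanFinish O d i) : P.CanFinish O c i :=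
  let ⟨e, he, hi⟩ := hd
  ⟨e, he.head h, hi⟩

theorem Finished.canFinish (h : P.Finished c i) : P.CanFinish O c i := ⟨c, .refl, h⟩

theorem Private.ordered (h : P.Private O i c d) (hc : c.Ordered O) : d.Ordered O := by
  cases h with
  | insert x s h => exact O.isPriority_ownedBeats.pairwise_orderedInsert _ hc
  | null => exact Pairwise.nil
  | remove k x r h h' =>
    rw [OwnedConfig.Ordered, h'] at hc
    exact (pairwise_cons.1 hc).2

theorem Private.not_finished (h : P.Private O i c d) : ¬ P.Finished c i := by
  rintro ⟨v, hv⟩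
  cases h with
  | insert x s h => simp [h] at hv
  | null k h => simp [h] at hv
  | remove k x r h => simp [h] at hv

theorem Private.loc_of_ne (h : P.Private O i c d) (hij : j ≠ i) : d.loc j = c.loc j := by
  cases h <;> simp [hij]

theorem Private.unique (h : P.Private O i c d) (h' : P.Private O i c e) : d = e := by
  cases h <;> cases h' <;> simp_all

theorem Finished.of_reflTransGen (h : P.Finished c i) (hcd : ReflTransGen (P.Next O) c d) :
    P.Finished d i := by
  induction hcd with
  | refl => exact h
  | tail _ hn ih =>
    obtain ⟨j, hj⟩ := hn
    have hne : i ≠ j := by rintro rfl; exact hj.not_finished ih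
    simpa only [Finished, hj.loc_of_ne hne] using ih

/-- The owner of the head entry (anyone, if the object is empty) has returned or can take a private
step, whatever its next instruction is. -/
theorem exists_canFinish (hc : P.Terminates O c) : ∃ i, P.CanFinish O c i := by
  induction hc with
  | intro c _ ih =>
    have go : ∀ {d}, P.Next O c d → ∃ i, P.CanFinish O c i := fun {d} hd =>
      let ⟨i, hi⟩ := ih d hd
      ⟨i, hi.of_next hd⟩
    have key : ∀ i, (∃ j, P.CanFinish O c j) ∨ ∃ k, P.instr i (c.loc i) = .remove k := by
      intro i
      rcases h : P.instr i (c.loc i) with ⟨x, s⟩ | k | v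
      · exact Or.inl (go ⟨i, .insert x s h⟩)
      · exact Or.inr ⟨k, rfl⟩
      · exact Or.inl ⟨i, Finished.canFinish ⟨v, h⟩⟩
    rcases hs : c.items with _ | ⟨⟨x, i⟩, r⟩
    · rcases key 0 with h | ⟨k, hk⟩
      · exact h
      · exact go ⟨0, .null k hk hs⟩
    · rcases key i with h | ⟨k, hk⟩
      · exact h
      · exact go ⟨i, .remove k x r hk hs⟩

theorem exists_canFinish_of_next_of_next (he : P.Terminates O e)
    (hc : P.Next O c e) (hd : P.Next O d e) : ∃ i, P.CanFinish O c i ∧ P.CanFinish O d i :=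
  let ⟨i, hi⟩ := exists_canFinish he
  ⟨i, hi.of_next hc, hi.of_next hd⟩

/-- A process can finish alone when the object contains its own items only. -/
theorem canFinish_of_forall_mem_eq (hc : P.Terminates O c) (h : ∀ x ∈ c.items, x.2 = i)
    (hi : d.loc i = c.loc i) (hd : d.items = c.items) :
    P.CanFinish O c i ∧ P.CanFinish O d i := by
  induction hc generalizing d with
  | intro c _ ih =>
    rcases hp : P.instr i (c.loc i) with ⟨x, s⟩ | k | v
    · have hc' : P.Next O c _ := ⟨i, .insert x s hp⟩
      have hd' : P.Next O d _ := ⟨i, .insert x s (hi ▸ hp)⟩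
      have := ih _ hc' (d := ⟨update d.loc i s, d.items.orderedInsert O.OwnedBeats (x, i)⟩)
        (by
          intro y hy
          rcases (mem_orderedInsert _).1 hy with rfl | hy
          · rfl
          · exact h y hy)
        (by simp) (by simp [hd])
      exact ⟨this.1.of_next hc', this.2.of_next hd'⟩
    · rcases hs : c.items with _ | ⟨⟨x, i'⟩, r⟩
      · have hc' : P.Next O c _ := ⟨i, .null k hp hs⟩
        have hd' : P.Next O d _ := ⟨i, .null k (hi ▸ hp) (hd.trans hs)⟩
        have := ih _ hc' (d := ⟨update d.loc i (k none), []⟩) (by simp) (by simp) rfl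
        exact ⟨this.1.of_next hc', this.2.of_next hd'⟩
      · obtain rfl : i' = i := h (x, i') (by simp [hs])
        have hc' : P.Next O c _ := ⟨i', .remove k x r hp hs⟩
        have hd' : P.Next O d _ := ⟨i', .remove k x r (hi ▸ hp) (hd.trans hs)⟩
        have := ih _ hc' (d := ⟨update d.loc i' (k (some x)), r⟩)
          (fun y hy => h y (by simp [hs, show y ∈ r from hy])) (by simp) rfl
        exact ⟨this.1.of_next hc', this.2.of_next hd'⟩
    · exact ⟨Finished.canFinish ⟨v, hp⟩, Finished.canFinish ⟨v, hi ▸ hp⟩⟩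

/-- A pending removal of `(x, j)` by process `j` can be performed early while process `i` only
works in front of that entry. -/
theorem exists_canFinish_of_pending_remove (hij : i ≠ j) (hc : P.Terminates O c)
    (ho : c.Ordered O) {U D : List (α × Fin 2)} {x : α} {k : Option α → σ}
    (hU : ∀ u ∈ U, u.2 = i) (hk : P.instr j (c.loc j) = .remove k)
    (hs : c.items = U ++ (x, j) :: D) :
    ∃ z, P.CanFinish O c z ∧ P.CanFinish O ⟨update c.loc j (k (some x)), U ++ D⟩ z := by
  induction hc generalizing U D with
  | intro c _ ih =>
    set d : OwnedConfig α σ := ⟨update c.loc j (k (some x)), U ++ D⟩ with hd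
    have hi : d.loc i = c.loc i := by simp [hd, hij]
    have go : ∀ {c' d'}, P.Private O i c c' → P.Private O i d d' →
        (∃ z, P.CanFinish O c' z ∧ P.CanFinish O d' z) →
        ∃ z, P.CanFinish O c z ∧ P.CanFinish O d z := by
      rintro c' d' h h' ⟨z, hz, hz'⟩
      exact ⟨z, hz.of_next ⟨i, h⟩, hz'.of_next ⟨i, h'⟩⟩
    -- Process `i` runs in parallel in both configurations until it returns, or wants to remove
    -- while nothing is in front of `(x, j)`.
    rcases hp : P.instr i (c.loc i) with ⟨y, s⟩ | k' | v
    · have hc' : P.Private O i c _ := .insert y s hp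
      have hd' : P.Private O i d _ := .insert y s (hi ▸ hp)
      refine go hc' hd' ?_
      obtain ⟨U', D', h₁, h₂, h₃⟩ := orderedInsert_append_erase (y, i)
        (show (U ++ (x, j) :: D).Pairwise (Outranks O.OwnedBeats) from hs ▸ ho)
      have := ih _ ⟨i, hc'⟩ (hc'.ordered ho) (U := U') (D := D')
        (fun u hu => (h₃ u hu).elim (hU u) (fun h => by rw [h]))
        (by simpa [hij.symm] using hk) (by rw [hs]; exact h₁)
      simpa only [hd, h₂, update_comm hij] using this
    · rcases U with _ | ⟨⟨y, i'⟩, U⟩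
      -- The entry `(x, j)` is now at the head, so the pending removal leads from `c` to `d` itself.
      · have hc' : P.Next O c d := ⟨j, .remove k x D hk hs⟩
        obtain ⟨z, hz⟩ := exists_canFinish (Acc.inv (Acc.intro c ‹_›) hc')
        exact ⟨z, hz.of_next hc', hz⟩
      · obtain rfl : i' = i := hU (y, i') (by simp)
        have hc' : P.Private O i' c _ := .remove k' y _ hp hs
        have hd' : P.Private O i' d _ := .remove k' y (U ++ D) (hi ▸ hp) rfl
        refine go hc' hd' ?_
        have := ih _ ⟨i', hc'⟩ (hc'.ordered ho) (U := U) (D := D)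
          (fun u hu => hU u (by simp [hu])) (by simpa [hij.symm] using hk) rfl
        simpa only [hd, update_comm hij] using this
    · exact ⟨i, Finished.canFinish ⟨v, hp⟩, Finished.canFinish ⟨v, hi ▸ hp⟩⟩

/-- Two tied adjacent entries of different owners can be swapped. -/
theorem exists_canFinish_of_swap (hij : i ≠ j) (hc : P.Terminates O c)
    {U D : List (α × Fin 2)} {a b : α} (hab : Outranks O.OwnedBeats (a, i) (b, j))
    (hba : Outranks O.OwnedBeats (b, j) (a, i)) (hs : c.items = U ++ (a, i) :: (b, j) :: D) :
    ∃ z, P.CanFinish O c z ∧ P.CanFinish O ⟨c.loc, U ++ (b, j) :: (a, i) :: D⟩ z := by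
  induction hc generalizing U D with
  | intro c hacc ih =>
    set d : OwnedConfig α σ := ⟨c.loc, U ++ (b, j) :: (a, i) :: D⟩ with hd
    have go : ∀ {p c' d'}, P.Private O p c c' → P.Private O p d d' →
        (∃ z, P.CanFinish O c' z ∧ P.CanFinish O d' z) →
        ∃ z, P.CanFinish O c z ∧ P.CanFinish O d z := by
      rintro p c' d' h h' ⟨z, hz, hz'⟩
      exact ⟨z, hz.of_next ⟨p, h⟩, hz'.of_next ⟨p, h'⟩⟩
    have key : ∀ p, (∃ z, P.CanFinish O c z ∧ P.CanFinish O d z) ∨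
        ∃ k, P.instr p (c.loc p) = .remove k := by
      intro p
      rcases hp : P.instr p (c.loc p) with ⟨y, s⟩ | k | v
      · left
        have hc' : P.Private O p c _ := .insert y s hp
        have hd' : P.Private O p d _ := .insert y s hp
        refine go hc' hd' ?_
        obtain ⟨U', D', h₁, h₂⟩ := orderedInsert_append_swap hab hba (y, p) U D
        have := ih _ ⟨p, hc'⟩ (U := U') (D := D') (by rw [hs]; exact h₁)
        simpa only [hd, h₂] using this
      · exact Or.inr ⟨k, rfl⟩
      · exact Or.inl ⟨p, Finished.canFinish ⟨v, hp⟩, Finished.canFinish ⟨v, hp⟩⟩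
    rcases U with _ | ⟨⟨y, p⟩, U⟩
    -- With the tied pair in front, only the case where both owners are about to remove remains.
    -- Each removes its own entry, and the two orders lead to the same configuration.
    · rcases key i with h | ⟨k, hk⟩
      · exact h
      rcases key j with h | ⟨k', hk'⟩
      · exact h
      have hc₁ : P.Next O c _ := ⟨i, .remove k a _ hk hs⟩
      have hc₂ : P.Next O _ _ := ⟨j, .remove (c := ⟨update c.loc i (k (some a)), (b, j) :: D⟩)
        k' b D (by simpa [hij.symm] using hk') rfl⟩
      have hd₁ : P.Next O d _ := ⟨j, .remove k' b _ hk' rfl⟩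
      have hd₂ : P.Next O _ _ := ⟨i, .remove (c := ⟨update c.loc j (k' (some b)), (a, i) :: D⟩)
        k a D (by simpa [hij] using hk) rfl⟩
      obtain ⟨z, hz⟩ := exists_canFinish ((hacc _ hc₁).inv hc₂)
      refine ⟨z, (hz.of_next hc₂).of_next hc₁, CanFinish.of_next hd₁ (CanFinish.of_next hd₂ ?_)⟩
      simpa only [update_comm hij] using hz
    · rcases key p with h | ⟨k, hk⟩
      · exact h
      have hc' : P.Private O p c _ := .remove k y _ hk hs
      have hd' : P.Private O p d _ := .remove k y _ hk rfl
      exact go hc' hd' (ih _ ⟨p, hc'⟩ rfl)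

/-! ### Local confluence and valence -/

theorem exists_canFinish_of_insert_of_remove (hij : i ≠ j) (hc : P.Terminates O c)
    (ho : c.Ordered O) {x : α} {s : σ} {k : Option α → σ}
    (hi : P.instr i (c.loc i) = .insert x s) (hj : P.instr j (c.loc j) = .remove k)
    (hd : P.Private O i c d) (he : P.Private O j c e) :
    ∃ z, P.CanFinish O d z ∧ P.CanFinish O e z := by
  have hd' : d = ⟨update c.loc i s, c.items.orderedInsert O.OwnedBeats (x, i)⟩ :=
    hd.unique (.insert x s hi)
  have hdj : P.instr j (d.loc j) = .remove k := by rw [hd.loc_of_ne hij.symm, hj]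
  have hei : P.instr i (e.loc i) = .insert x s := by rw [he.loc_of_ne hij, hi]
  have hef : P.Next O e _ := ⟨i, .insert x s hei⟩
  have hdt : P.Terminates O d := hc.inv ⟨i, hd⟩
  rcases hs : c.items with _ | ⟨⟨a, p⟩, r⟩
  · have he' := he.unique (.null k hj hs)
    subst hd' he'
    -- The null response of `j` is possible only before the insertion, so the steps do not commute;
    -- but afterwards all items belong to `i`, which finishes alone without noticing.
    have := canFinish_of_forall_mem_eq (i := i) hdt (by simp [hs])
      (d := ⟨update (update c.loc j (k none)) i s, [(x, i)]⟩) (by simp) (by simp [hs])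
    exact ⟨i, this.1, this.2.of_next hef⟩
  · obtain rfl : p = j := by
      cases he with
      | insert x s h => simp [hj] at h
      | null k h h' => simp [hs] at h'
      | remove k y r h h' => simp_all
    have he' := he.unique (.remove k a r hj hs)
    rw [OwnedConfig.Ordered, hs] at ho
    -- If `x` goes in front of `a`, it blocks the removal by `p`, which stays pending. Otherwise the
    -- two steps commute.
    by_cases hb : O.OwnedBeats (x, i) (a, p)
    · have hall := forall_rel_of_pairwise_outranks ho hb
      have hditems : d.items = [(x, i)] ++ (a, p) :: r := by
        rw [hd', hs]; exact orderedInsert_of_forall hall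
      have hr : r.orderedInsert O.OwnedBeats (x, i) = (x, i) :: r :=
        orderedInsert_of_forall fun b hb => hall b (mem_cons_of_mem _ hb)
      obtain ⟨z, hz, hz'⟩ := exists_canFinish_of_pending_remove hij hdt
        (hd.ordered (by rwa [OwnedConfig.Ordered, hs])) (by simp) hdj hditems
      refine ⟨z, hz, CanFinish.of_next hef ?_⟩
      subst hd' he'
      simpa only [hr, update_comm hij, singleton_append] using hz'
    · have hditems : d.items = (a, p) :: r.orderedInsert O.OwnedBeats (x, i) := by
        rw [hd', hs]; simp only [orderedInsert, hb, if_false]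
      have hdf : P.Next O d _ := ⟨p, .remove k a _ hdj hditems⟩
      refine exists_canFinish_of_next_of_next (hdt.inv hdf) hdf ?_
      subst hd' he'
      simpa only [update_comm hij] using hef

theorem exists_canFinish_of_private_of_private (hij : i ≠ j) (hc : P.Terminates O c)
    (ho : c.Ordered O) (hd : P.Private O i c d) (he : P.Private O j c e) :
    ∃ z, P.CanFinish O d z ∧ P.CanFinish O e z := by
  rcases hi : P.instr i (c.loc i) with ⟨x, s⟩ | k | v
  · rcases hj : P.instr j (c.loc j) with ⟨y, s'⟩ | k' | v'
    · have hd' := hd.unique (.insert x s hi)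
      have he' := he.unique (.insert y s' hj)
      have hdf : P.Private O j d _ := .insert y s' (by rw [hd.loc_of_ne hij.symm, hj])
      have hef : P.Private O i e _ := .insert x s (by rw [he.loc_of_ne hij, hi])
      have ht : P.Terminates O _ := (hc.inv ⟨i, hd⟩).inv ⟨j, hdf⟩
      have ho₁ := hdf.ordered (hd.ordered ho)
      have ho₂ := hef.ordered (he.ordered ho)
      suffices h : ∃ z, P.CanFinish O _ z ∧ P.CanFinish O _ z from
        let ⟨z, hz, hz'⟩ := h
        ⟨z, hz.of_next ⟨j, hdf⟩, hz'.of_next ⟨i, hef⟩⟩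
      subst hd' he'
      simp only [update_comm hij] at *
      rcases O.isPriority_ownedBeats.orderedInsert_comm_or_swap (x, i) (y, j) c.items with
        h | ⟨U, D, a, b, hab, h₁, h₂⟩
      · obtain ⟨z, hz⟩ := exists_canFinish ht
        exact ⟨z, hz, by simpa only [h] using hz⟩
      · have h_ab : Outranks O.OwnedBeats a b := by
          have : (U ++ a :: b :: D).Pairwise (Outranks O.OwnedBeats) := h₁ ▸ ho₁
          exact (pairwise_cons.1 (pairwise_append.1 this).2.1).1 b (by simp)
        have h_ba : Outranks O.OwnedBeats b a := by
          have : (U ++ b :: a :: D).Pairwise (Outranks O.OwnedBeats) := h₂ ▸ ho₂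
          exact (pairwise_cons.1 (pairwise_append.1 this).2.1).1 a (by simp)
        rcases hab with ⟨rfl, rfl⟩ | ⟨rfl, rfl⟩
        · simpa only [h₂] using exists_canFinish_of_swap hij ht h_ab h_ba h₁
        · simpa only [h₂] using exists_canFinish_of_swap hij.symm ht h_ab h_ba h₁
    · exact exists_canFinish_of_insert_of_remove hij hc ho hi hj hd he
    · exact absurd ⟨v', hj⟩ he.not_finished
  · rcases hj : P.instr j (c.loc j) with ⟨y, s'⟩ | k' | v'
    · obtain ⟨z, hz, hz'⟩ := exists_canFinish_of_insert_of_remove hij.symm hc ho hj hi he hd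
      exact ⟨z, hz', hz⟩
    -- A nonempty object has one head, which only its owner can remove privately.
    · have hs : c.items = [] := by
        cases hd with
        | insert x s h => simp [hi] at h
        | null _ _ h => exact h
        | remove _ _ _ _ h =>
          cases he with
          | insert x s h => simp [hj] at h
          | null _ _ h => exact h
          | remove _ _ _ _ h' => simp_all
      have hd' := hd.unique (.null k hi hs)
      have he' := he.unique (.null k' hj hs)
      have hdf : P.Next O d _ :=
        ⟨j, .null k' (by rw [hd.loc_of_ne hij.symm, hj]) (by rw [hd'])⟩
      have hef : P.Next O e _ := ⟨i, .null k (by rw [he.loc_of_ne hij, hi]) (by rw [he'])⟩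
      refine exists_canFinish_of_next_of_next ((hc.inv ⟨i, hd⟩).inv hdf) hdf ?_
      subst hd' he'
      simpa only [update_comm hij] using hef
    · exact absurd ⟨v', hj⟩ he.not_finished
  · exact absurd ⟨v, hi⟩ hd.not_finished

/-- If the processes never both return, then only one of them can return. -/
theorem not_canFinish_and_canFinish (hc : P.Terminates O c) (ho : c.Ordered O)
    (hf : ∀ d, ReflTransGen (P.Next O) c d → ¬ (P.Finished d 0 ∧ P.Finished d 1)) :
    ¬ (P.CanFinish O c 0 ∧ P.CanFinish O c 1) := by
  induction hc with
  | intro c hacc ih =>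
    rintro ⟨⟨d₀, h₀, hd₀⟩, ⟨d₁, h₁, hd₁⟩⟩
    rcases h₀.cases_head with rfl | ⟨e₀, ⟨i, hi⟩, h₀'⟩
    · exact hf d₁ h₁ ⟨hd₀.of_reflTransGen h₁, hd₁⟩
    rcases h₁.cases_head with rfl | ⟨e₁, ⟨j, hj⟩, h₁'⟩
    · exact hf d₀ h₀ ⟨hd₀, hd₁.of_reflTransGen h₀⟩
    have n₀ := ih e₀ ⟨i, hi⟩ (hi.ordered ho) fun d hd => hf d (hd.head ⟨i, hi⟩)
    have n₁ := ih e₁ ⟨j, hj⟩ (hj.ordered ho) fun d hd => hf d (hd.head ⟨j, hj⟩)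
    have c₀ : P.CanFinish O e₀ 0 := ⟨d₀, h₀', hd₀⟩
    have c₁ : P.CanFinish O e₁ 1 := ⟨d₁, h₁', hd₁⟩
    by_cases hij : i = j
    · subst hij
      obtain rfl := hi.unique hj
      exact n₀ ⟨c₀, c₁⟩
    -- Whichever process `z` is, one of the two successors then lets both processes finish, against
    -- the induction hypothesis.
    · obtain ⟨z, hz₀, hz₁⟩ := exists_canFinish_of_private_of_private hij ⟨c, hacc⟩ ho hi hj
      fin_cases z
      · exact n₁ ⟨hz₁, c₁⟩
      · exact n₀ ⟨c₀, hz₀⟩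

/-! ### Relation to actual executions -/

/-- The actual configuration `c` and the owned configuration `d` agree. -/
def Simulates (O : ConsistentSet α) (c : Config α σ) (d : OwnedConfig α σ) : Prop :=
  c.loc = d.loc ∧ O.RemovalOrder c.items (d.items.map Prod.fst)

theorem Simulates.step {c : Config α σ} (h : Simulates O c d) (hd : P.Private O i d e) :
    Simulates O (P.step O c i) e := by
  obtain ⟨h₁, h₂⟩ := h
  cases hd with
  | insert x s hp =>
    simp only [Protocol.step, h₁, hp]
    refine ⟨rfl, ?_⟩
    have := h₂.insert x
    rwa [← map_orderedInsert_comap Prod.fst (x, i)] at this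
  | null k hp hs =>
    simp only [Protocol.step, h₁, hp]
    refine ⟨?_, ?_⟩
    · simp [h₂.removeResponse_eq, hs]
    · simpa [hs] using h₂.removeState
  | remove k x r hp hs =>
    simp only [Protocol.step, h₁, hp]
    refine ⟨?_, ?_⟩
    · simp [h₂.removeResponse_eq, hs]
    · simpa [hs] using h₂.removeState

theorem exec_congr {l₀ : List α} {inp : Fin 2 → V} {s s' : ℕ → Fin 2} {n : ℕ}
    (h : ∀ m < n, s m = s' m) : P.exec O l₀ inp s n = P.exec O l₀ inp s' n := by
  induction n with
  | zero => rfl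
  | succ n ih => rw [exec, exec, ih fun m hm => h m (by omega), h n (by omega)]

variable (P) in
/-- The initial configuration. -/
def init (inp : Fin 2 → V) : OwnedConfig α σ := ⟨fun i => P.start i (inp i), []⟩

theorem exists_exec_simulates {inp : Fin 2 → V} (h : ReflTransGen (P.Next O) (P.init inp) d) :
    ∃ s n, Simulates O (P.exec O [] inp s n) d := by
  induction h with
  | refl => exact ⟨fun _ => 0, 0, rfl, rfl⟩
  | tail _ hn ih =>
    obtain ⟨s, n, h⟩ := ih
    obtain ⟨i, hi⟩ := hn
    refine ⟨update s n i, n + 1, ?_⟩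
    have : P.exec O [] inp (update s n i) n = P.exec O [] inp s n :=
      exec_congr fun m hm => by simp [hm.ne]
    rw [exec, this, update_self]
    exact h.step hi

/-! ### Comparison with solo runs -/

variable (P O) in
/-- The first `n` steps of process `i` running alone. -/
abbrev solo (inp : Fin 2 → V) (i : Fin 2) (n : ℕ) : Config α σ := P.exec O [] inp (fun _ => i) n

variable (P O) in
/-- In `d`, every process `i` is where it is after `n i` steps alone. -/
def LooksSolo (inp : Fin 2 → V) (d : OwnedConfig α σ) (n : Fin 2 → ℕ) : Prop :=
  ∀ i, (P.solo O inp i (n i)).loc i = d.loc i ∧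
    O.RemovalOrder (P.solo O inp i (n i)).items
      ((d.items.filter fun x => x.2 = i).map Prod.fst)

theorem LooksSolo.next {inp : Fin 2 → V} {n : Fin 2 → ℕ} (h : P.LooksSolo O inp d n)
    (ho : d.Ordered O) (hd : P.Private O i d e) :
    P.LooksSolo O inp e (update n i (n i + 1)) := by
  intro j
  obtain ⟨h₁, h₂⟩ := h j
  by_cases hj : j = i
  · subst hj
    rw [update_self, solo, exec]
    cases hd with
    | insert x s hp =>
      simp only [Protocol.step, h₁, hp, update_self, true_and]
      have := h₂.insert x
      rw [filter_orderedInsert_of_pairwise _ _ ho]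
      simp only [decide_true, if_true]
      rwa [← map_orderedInsert_comap Prod.fst (x, j)] at this
    | null k hp hs =>
      simp only [Protocol.step, h₁, hp, update_self]
      refine ⟨?_, ?_⟩
      · simp [h₂.removeResponse_eq, hs]
      · simpa [hs] using h₂.removeState
    | remove k x r hp hs =>
      simp only [Protocol.step, h₁, hp, update_self]
      refine ⟨?_, ?_⟩
      · simp [h₂.removeResponse_eq, hs]
      · simpa [hs] using h₂.removeState
  · rw [update_of_ne hj, hd.loc_of_ne hj]
    refine ⟨h₁, ?_⟩
    cases hd with
    | insert x s hp =>
      rw [filter_orderedInsert_of_pairwise _ _ ho]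
      simpa [Ne.symm hj] using h₂
    | null k hp hs => simpa [hs] using h₂
    | remove k x r hp hs => simpa [hs, Ne.symm hj] using h₂

theorem looksSolo_init (inp : Fin 2 → V) : P.LooksSolo O inp (P.init inp) 0 :=
  fun _ => ⟨rfl, rfl⟩

theorem exists_looksSolo {inp : Fin 2 → V} (h : ReflTransGen (P.Next O) (P.init inp) d) :
    d.Ordered O ∧ ∃ n, P.LooksSolo O inp d n := by
  induction h with
  | refl => exact ⟨Pairwise.nil, 0, looksSolo_init inp⟩
  | tail _ hn ih =>
    obtain ⟨i, hi⟩ := hn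
    obtain ⟨ho, n, h⟩ := ih
    exact ⟨hi.ordered ho, _, h.next ho hi⟩

theorem decision_eq_some {c : Config α σ} {v : V} :
    P.decision c i = some v ↔ P.instr i (c.loc i) = .decide v := by
  unfold decision
  split <;> simp_all

theorem solo_decision_of_le {inp : Fin 2 → V} {m n : ℕ} (hmn : m ≤ n) {v : V}
    (h : P.instr i ((P.solo O inp i m).loc i) = .decide v) :
    P.instr i ((P.solo O inp i n).loc i) = .decide v := by
  induction n, hmn using Nat.le_induction with
  | base => exact h
  | succ n _ ih =>
    have : P.solo O inp i (n + 1) = P.solo O inp i n := by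
      simp only [solo] at ih
      simp only [solo, exec, Protocol.step, ih]
    rw [this, ih]

theorem WaitFree.terminates (hw : P.WaitFree O []) (inp : Fin 2 → V) :
    P.Terminates O (P.init inp) := by
  have hN : ∀ i, ∃ N v, P.instr i ((P.solo O inp i N).loc i) = .decide v := by
    intro i
    obtain ⟨n, v, h⟩ := hw inp (fun _ => i) i fun n => ⟨n, le_rfl, rfl⟩
    exact ⟨n, v, decision_eq_some.1 h⟩
  choose N v hv using hN
  -- Each private step of `i` advances its solo run, which has returned by time `N i`; the total
  -- number of remaining solo steps decreases.
  suffices h : ∀ (M : ℕ) (d : OwnedConfig α σ) (n : Fin 2 → ℕ), d.Ordered O →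
      P.LooksSolo O inp d n → (N 0 - n 0) + (N 1 - n 1) = M → P.Terminates O d from
    h _ _ _ Pairwise.nil (looksSolo_init inp) rfl
  intro M
  induction M using Nat.strong_induction_on with
  | _ M ih =>
    intro d n ho h hM
    refine ⟨d, fun e he => ?_⟩
    obtain ⟨i, hi⟩ := he
    have hlt : n i < N i := by
      by_contra hge
      refine hi.not_finished ⟨v i, ?_⟩
      rw [← (h i).1]
      exact solo_decision_of_le (not_lt.1 hge) (hv i)
    refine ih _ ?_ e _ (hi.ordered ho) (h.next ho hi) rfl
    fin_cases i <;> simp at hlt ⊢ <;> omega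

theorem solo_congr {inp inp' : Fin 2 → V} (h : inp i = inp' i) (n : ℕ) :
    (P.solo O inp i n).loc i = (P.solo O inp' i n).loc i ∧
      (P.solo O inp i n).items = (P.solo O inp' i n).items := by
  induction n with
  | zero => simp [solo, exec, h]
  | succ n ih =>
    obtain ⟨h₁, h₂⟩ := ih
    simp only [solo, exec, Protocol.step] at h₁ h₂ ⊢
    rw [h₁, h₂]
    split <;> simp_all

/-- A process that runs alone returns its own input. -/
theorem Validity.solo_eq (hv : P.Validity O []) {inp : Fin 2 → V} {n : ℕ} {v : V}
    (h : P.instr i ((P.solo O inp i n).loc i) = .decide v) : v = inp i := by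
  -- The solo run ignores the other input, so that input may be replaced by `inp i`, which leaves
  -- validity a single value.
  rw [(solo_congr (inp' := fun _ => inp i) rfl n).1] at h
  obtain ⟨_, h⟩ := hv _ _ n i v (decision_eq_some.2 h)
  exact h

end Protocol

theorem mainTheorem1 {α V σ : Type*} [Nontrivial V] (O : ConsistentSet α) :
    ¬ ∃ P : Protocol α V σ, P.SolvesConsensus O [] := by
  rintro ⟨P, hw, ha, hv⟩
  obtain ⟨a, b, hab⟩ := exists_pair_ne V
  have ht := hw.terminates ![a, b]
  have alone : ∀ i, P.CanFinish O (P.init ![a, b]) i := fun i =>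
    (Protocol.canFinish_of_forall_mem_eq ht (by simp [Protocol.init]) rfl rfl).1
  refine Protocol.not_canFinish_and_canFinish ht List.Pairwise.nil ?_ ⟨alone 0, alone 1⟩
  -- If both returned privately, the solo views would give the outputs `a` and `b`, and the
  -- corresponding actual execution would violate agreement.
  rintro d hd ⟨⟨v, h₀⟩, ⟨w, h₁⟩⟩
  obtain ⟨-, n, hn⟩ := Protocol.exists_looksSolo hd
  obtain ⟨s, m, hs, -⟩ := Protocol.exists_exec_simulates hd
  have hva : v = a := hv.solo_eq (by rw [(hn 0).1]; exact h₀)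
  have hwb : w = b := hv.solo_eq (by rw [(hn 1).1]; exact h₁)
  have hvw : v = w := ha ![a, b] s m v w
    (Protocol.decision_eq_some.2 (by rw [hs, h₀])) (Protocol.decision_eq_some.2 (by rw [hs, h₁]))
  exact hab (hva ▸ hwb ▸ hvw)
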